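/- Let $\mu$ be a $\sigma$-finite measure on a measurable space $(\Omega,\mathscr F)$. Let $\Phi:[0,\infty)\to[0,\infty]$ be an Orlicz function, i.e. $\Phi$ is left continuous, increasing and convex, $\Phi(0)=0$, and $\Phi$ is non-trivial ($\Phi(t)>0$ for some $t>0$ and $\Phi(t)<\infty$ for some $t>0$). Let $\Psi(s)=\sup\{ts-\Phi(t): t\ge 0\}$ be its conjugate, which is again an Orlicz function. For an Orlicz function $\Theta$, let $L_\Theta(\mu)$ be the vector space of all real-valued measurable functions $f$ on $\Omega$ (modulo $\mu$-a.e. equality) with $$\|f\|_\Theta=\inf\Big\{\lambda>0:\int_\Omega\Theta\Big(\frac{|f|}{\lambda}\Big)\,d\mu\le 1\Big\}<\infty ,$$ and let $H_\Theta(\mu)$ be the set of all $f\in L_\Theta(\mu)$ with $\int_\Omega\Theta(|f|/\lambda)\,d\mu<\infty$ for every $\lambda>0$. The weak* topology on $L_\Phi(\mu)$ is $\sigma(L_\Phi(\mu),H_\Psi(\mu))$, the coarsest topology that makes $f\mapsto\int_\Omega fg\,d\mu$ continuous for every $g\in H_\Psi(\mu)$. **Theorem.** Suppose that $\lim_{t\to\infty}\Phi(t)/t=\infty$.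 Then for every convex set $C\subseteq L_\Phi(\mu)$ and every $f$ in the weak* closure $\overline{C}^{w^*}$ of $C$, there is a sequence $(f_n)$ in $C$ such that $f_n\to f$ $\mu$-almost everywhere. -/

import Mathlib

open MeasureTheory Filter Topology
open scoped ENNReal NNReal

/-- An Orlicz function `Φ : [0, ∞) → [0, ∞]`: left continuous, increasing, convex, vanishing at `0`
and nontrivial (neither identically `0` nor identically `∞` on `(0, ∞)`). -/
structure OrliczFunction where
  /-- the underlying function -/
  toFun : ℝ≥0 → ℝ≥0∞
  map_zero : toFun 0 = 0
  mono : Monotone toFun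
  convex : ConvexOn ℝ≥0 Set.univ toFun
  leftCont : ∀ t, ContinuousWithinAt toFun (Set.Iio t) t
  exists_pos : ∃ t, 0 < t ∧ 0 < toFun t
  exists_lt_top : ∃ t, 0 < t ∧ toFun t < ⊤

namespace OrliczFunction

instance : CoeFun OrliczFunction fun _ => ℝ≥0 → ℝ≥0∞ := ⟨toFun⟩

/-- The formula `Ψ(s) = sup {t s - Φ(t) : t ≥ 0}`. Truncating the difference at `0`
(in particular where `Φ t = ∞`) does not change the supremum, as `t = 0` contributes `0`. -/
noncomputable def conjugateFun (Φ : OrliczFunction) (s : ℝ≥0) : ℝ≥0∞ :=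
  ⨆ t : ℝ≥0, ((t : ℝ≥0∞) * s - Φ t)

theorem mul_le_add_conjugateFun (Φ : OrliczFunction) (t s : ℝ≥0) :
    (t : ℝ≥0∞) * s ≤ Φ t + Φ.conjugateFun s := by
  rw [← tsub_le_iff_left]
  exact le_iSup (fun t : ℝ≥0 => ((t : ℝ≥0∞) * s - Φ t)) t

theorem conjugateFun_mono (Φ : OrliczFunction) : Monotone Φ.conjugateFun := by
  intro s s' h
  exact iSup_mono fun t => tsub_le_tsub_right (by gcongr) _

theorem conjugateFun_convex (Φ : OrliczFunction) : ConvexOn ℝ≥0 Set.univ Φ.conjugateFun := by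
  refine ⟨convex_univ, fun x _ y _ a b _ _ hab => ?_⟩
  refine iSup_le fun t => ?_
  rw [tsub_le_iff_left]
  have h1 := Φ.mul_le_add_conjugateFun t x
  have h2 := Φ.mul_le_add_conjugateFun t y
  have hab' : (a : ℝ≥0∞) + b = 1 := by exact_mod_cast hab
  simp only [ENNReal.smul_def, smul_eq_mul, ENNReal.coe_add, ENNReal.coe_mul]
  calc (t : ℝ≥0∞) * (a * x + b * y) = a * (t * x) + b * (t * y) := by ring
    _ ≤ a * (Φ t + Φ.conjugateFun x) + b * (Φ t + Φ.conjugateFun y) := by gcongr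
    _ = (a + b) * Φ t + (a * Φ.conjugateFun x + b * Φ.conjugateFun y) := by ring
    _ = _ := by rw [hab', one_mul]

theorem conjugateFun_leftCont (Φ : OrliczFunction) (s : ℝ≥0) :
    ContinuousWithinAt Φ.conjugateFun (Set.Iio s) s := by
  refine tendsto_order.2 ⟨fun a ha => ?_, fun a ha => ?_⟩
  · obtain ⟨t, ht⟩ := lt_iSup_iff.1 ha
    have hc : Continuous fun s : ℝ≥0 => (t : ℝ≥0∞) * s - Φ t :=
      (ENNReal.continuous_sub_right (Φ t)).comp
        ((ENNReal.continuous_const_mul ENNReal.coe_ne_top).comp ENNReal.continuous_coe)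
    have := (hc.tendsto s).eventually (lt_mem_nhds ht)
    filter_upwards [mem_nhdsWithin_of_mem_nhds this] with u hu
    exact lt_of_lt_of_le hu (le_iSup (fun t : ℝ≥0 => ((t : ℝ≥0∞) * u - Φ t)) t)
  · filter_upwards [self_mem_nhdsWithin] with u hu
    exact lt_of_le_of_lt (Φ.conjugateFun_mono (le_of_lt hu)) ha

theorem exists_conjugateFun_pos (Φ : OrliczFunction) : ∃ s, 0 < s ∧ 0 < Φ.conjugateFun s := by
  obtain ⟨t, ht, hΦ⟩ := Φ.exists_lt_top
  refine ⟨(Φ t).toNNReal / t + 1, by positivity, ?_⟩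
  refine lt_of_lt_of_le ?_ (le_iSup (fun u : ℝ≥0 => ((u : ℝ≥0∞) * _ - Φ u)) t)
  rw [tsub_pos_iff_lt]
  conv_lhs => rw [← ENNReal.coe_toNNReal hΦ.ne]
  rw [← ENNReal.coe_mul, ENNReal.coe_lt_coe, mul_add, mul_div_cancel₀ _ ht.ne']
  simpa using ht

theorem exists_conjugateFun_lt_top (Φ : OrliczFunction) :
    ∃ s, 0 < s ∧ Φ.conjugateFun s < ⊤ := by
  obtain ⟨u, hu, hΦ⟩ := Φ.exists_pos
  obtain ⟨p, hp, hpΦ⟩ : ∃ p : ℝ≥0, 0 < p ∧ (p : ℝ≥0∞) ≤ Φ u := by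
    obtain ⟨p, hp, hp'⟩ := ENNReal.lt_iff_exists_nnreal_btwn.1 hΦ
    exact ⟨p, by exact_mod_cast hp, hp'.le⟩
  refine ⟨p / u, by positivity, lt_of_le_of_lt (b := (p : ℝ≥0∞)) ?_ ENNReal.coe_lt_top⟩
  refine iSup_le fun t => ?_
  rw [tsub_le_iff_left]
  rcases le_total t u with h | h
  · refine le_trans ?_ le_add_self
    rw [← ENNReal.coe_mul, ENNReal.coe_le_coe, mul_div_assoc', div_le_iff₀ hu, mul_comm]
    gcongr
  · refine le_trans ?_ le_self_add
    have ht : 0 < t := lt_of_lt_of_le hu h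
    have hut : u / t ≤ 1 := div_le_one_of_le₀ h zero_le
    have := Φ.convex.2 (Set.mem_univ t) (Set.mem_univ 0) (zero_le : 0 ≤ u / t)
      (zero_le : 0 ≤ 1 - u / t) (add_tsub_cancel_of_le hut)
    simp only [smul_eq_mul, mul_zero, add_zero, div_mul_cancel₀ _ ht.ne', Φ.map_zero,
      smul_zero, ENNReal.smul_def] at this
    have h2 := hpΦ.trans this
    calc (t : ℝ≥0∞) * ((p / u : ℝ≥0) : ℝ≥0∞) = ((t / u : ℝ≥0) : ℝ≥0∞) * p := by
          rw [← ENNReal.coe_mul, ← ENNReal.coe_mul]; congr 1; field_simp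
      _ ≤ ((t / u : ℝ≥0) : ℝ≥0∞) * (((u / t : ℝ≥0) : ℝ≥0∞) * Φ t) := by gcongr
      _ = Φ t := by
          rw [← mul_assoc, ← ENNReal.coe_mul, show t / u * (u / t) = 1 by field_simp]; simp

/-- The conjugate Orlicz function `Ψ` of `Φ`. -/
noncomputable def conjugate (Φ : OrliczFunction) : OrliczFunction where
  toFun := Φ.conjugateFun
  map_zero := by simp [conjugateFun]
  mono := Φ.conjugateFun_mono
  convex := Φ.conjugateFun_convex
  leftCont := Φ.conjugateFun_leftCont
  exists_pos := Φ.exists_conjugateFun_pos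
  exists_lt_top := Φ.exists_conjugateFun_lt_top

end OrliczFunction

section OrliczSpaces

variable {Ω : Type*} [MeasurableSpace Ω]

/-- The modular `∫ Φ(|f| / c) dμ`. -/
noncomputable def orliczModular (Φ : OrliczFunction) (μ : Measure Ω) (c : ℝ≥0)
    (f : Ω →ₘ[μ] ℝ) : ℝ≥0∞ :=
  ∫⁻ x, Φ (‖f x‖₊ / c) ∂μ

/-- The Luxemburg norm `inf {c > 0 : ∫ Φ(|f| / c) dμ ≤ 1}`, with `inf ∅ = ∞`. -/
noncomputable def luxemburgNorm (Φ : OrliczFunction) (μ : Measure Ω) (f : Ω →ₘ[μ] ℝ) : ℝ≥0∞ :=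
  ⨅ (c : ℝ≥0) (_ : 0 < c ∧ orliczModular Φ μ c f ≤ 1), (c : ℝ≥0∞)

theorem luxemburgNorm_lt_top_iff {Φ : OrliczFunction} {μ : Measure Ω} {f : Ω →ₘ[μ] ℝ} :
    luxemburgNorm Φ μ f < ⊤ ↔ ∃ c : ℝ≥0, 0 < c ∧ orliczModular Φ μ c f ≤ 1 := by
  simp [luxemburgNorm, iInf_lt_iff]

theorem orliczModular_zero (Φ : OrliczFunction) (μ : Measure Ω) (c : ℝ≥0) :
    orliczModular Φ μ c 0 = 0 := by
  rw [orliczModular, ← lintegral_zero (μ := μ)]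
  refine lintegral_congr_ae ?_
  filter_upwards [AEEqFun.coeFn_zero (μ := μ) (β := ℝ)] with x hx
  simp [hx, Φ.map_zero]

theorem orliczModular_smul (Φ : OrliczFunction) (μ : Measure Ω) (c : ℝ≥0) {k : ℝ} (hk : k ≠ 0)
    (f : Ω →ₘ[μ] ℝ) : orliczModular Φ μ c (k • f) = orliczModular Φ μ (c / ‖k‖₊) f := by
  refine lintegral_congr_ae ?_
  filter_upwards [AEEqFun.coeFn_smul k f] with x hx
  have : ‖k‖₊ ≠ 0 := by simpa using hk
  rw [hx, Pi.smul_apply, nnnorm_smul, div_div_eq_mul_div, mul_comm]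

theorem orliczModular_add_le (Φ : OrliczFunction) (μ : Measure Ω) {a b : ℝ≥0} (ha : 0 < a)
    (hb : 0 < b) (f g : Ω →ₘ[μ] ℝ) :
    orliczModular Φ μ (a + b) (f + g) ≤
      ((a / (a + b) : ℝ≥0) : ℝ≥0∞) * orliczModular Φ μ a f +
        ((b / (a + b) : ℝ≥0) : ℝ≥0∞) * orliczModular Φ μ b g := by
  have hm (c : ℝ≥0) (h : Ω →ₘ[μ] ℝ) : Measurable fun x => Φ (‖h x‖₊ / c) :=
    Φ.mono.measurable.comp (h.measurable.nnnorm.div_const c)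
  unfold orliczModular
  rw [← lintegral_const_mul _ (hm a f), ← lintegral_const_mul _ (hm b g),
    ← lintegral_add_left ((hm a f).const_mul _)]
  refine lintegral_mono_ae ?_
  filter_upwards [AEEqFun.coeFn_add f g] with x hx
  have hs : 0 < a + b := by positivity
  have h1 : a / (a + b) + b / (a + b) = 1 := by field_simp
  have h2 := Φ.convex.2 (Set.mem_univ (‖f x‖₊ / a)) (Set.mem_univ (‖g x‖₊ / b))
    (zero_le : 0 ≤ a / (a + b)) (zero_le : 0 ≤ b / (a + b)) h1
  simp only [ENNReal.smul_def, smul_eq_mul] at h2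
  refine le_trans (Φ.mono ?_) h2
  rw [hx, Pi.add_apply]
  calc ‖f x + g x‖₊ / (a + b) ≤ (‖f x‖₊ + ‖g x‖₊) / (a + b) := by
        gcongr; exact nnnorm_add_le _ _
    _ = _ := by field_simp

/-- The Orlicz space `L_Φ(μ)`: classes modulo a.e. equality of real-valued measurable functions
with finite Luxemburg norm, as a vector space. -/
noncomputable def orliczSpace (Φ : OrliczFunction) (μ : Measure Ω) :
    Submodule ℝ (Ω →ₘ[μ] ℝ) where
  carrier := {f | luxemburgNorm Φ μ f < ⊤}
  zero_mem' := luxemburgNorm_lt_top_iff.2 ⟨1, one_pos, by simp [orliczModular_zero]⟩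
  add_mem' := by
    rintro f g hf hg
    obtain ⟨a, ha, hfa⟩ := luxemburgNorm_lt_top_iff.1 hf
    obtain ⟨b, hb, hgb⟩ := luxemburgNorm_lt_top_iff.1 hg
    refine luxemburgNorm_lt_top_iff.2 ⟨a + b, by positivity, ?_⟩
    refine (orliczModular_add_le Φ μ ha hb f g).trans ?_
    calc _ ≤ ((a / (a + b) : ℝ≥0) : ℝ≥0∞) * 1 + ((b / (a + b) : ℝ≥0) : ℝ≥0∞) * 1 := by gcongr
      _ = 1 := by
        have : 0 < a + b := by positivity
        rw [mul_one, mul_one, ← ENNReal.coe_add, show a / (a + b) + b / (a + b) = 1 by field_simp,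
          ENNReal.coe_one]
  smul_mem' := by
    rintro k f hf
    obtain ⟨a, ha, hfa⟩ := luxemburgNorm_lt_top_iff.1 hf
    rcases eq_or_ne k 0 with rfl | hk
    · rw [zero_smul]
      exact luxemburgNorm_lt_top_iff.2 ⟨1, one_pos, by simp [orliczModular_zero]⟩
    · have hk' : 0 < ‖k‖₊ := by simpa using hk
      refine luxemburgNorm_lt_top_iff.2 ⟨a * ‖k‖₊, by positivity, ?_⟩
      rwa [orliczModular_smul Φ μ _ hk, mul_div_cancel_right₀ _ hk'.ne']

/-- The heart `H_Φ(μ)`: all `f ∈ L_Φ(μ)` with `∫ Φ(|f| / c) dμ < ∞` for every `c > 0`. -/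
noncomputable def orliczHeart (Φ : OrliczFunction) (μ : Measure Ω) :
    Submodule ℝ (Ω →ₘ[μ] ℝ) where
  carrier := {f | f ∈ orliczSpace Φ μ ∧ ∀ c : ℝ≥0, 0 < c → orliczModular Φ μ c f < ⊤}
  zero_mem' := ⟨zero_mem _, fun c _ => by simp [orliczModular_zero]⟩
  add_mem' := by
    rintro f g ⟨hf, hf'⟩ ⟨hg, hg'⟩
    refine ⟨add_mem hf hg, fun c hc => ?_⟩
    have hc2 : 0 < c / 2 := by positivity
    have := orliczModular_add_le Φ μ hc2 hc2 f g
    rw [add_halves] at this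
    exact this.trans_lt (ENNReal.add_lt_top.2 ⟨ENNReal.mul_lt_top ENNReal.coe_lt_top (hf' _ hc2),
      ENNReal.mul_lt_top ENNReal.coe_lt_top (hg' _ hc2)⟩)
  smul_mem' := by
    rintro k f ⟨hf, hf'⟩
    refine ⟨Submodule.smul_mem _ k hf, fun c hc => ?_⟩
    rcases eq_or_ne k 0 with rfl | hk
    · simp [orliczModular_zero]
    · have hk' : 0 < ‖k‖₊ := by simpa using hk
      rw [orliczModular_smul Φ μ _ hk]
      exact hf' _ (by positivity)

/-- The product of a function in `L_Φ(μ)` and a function in `H_Ψ(μ)` is integrable. -/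
theorem integrable_orlicz_mul {Φ : OrliczFunction} {μ : Measure Ω} {f g : Ω →ₘ[μ] ℝ}
    (hf : f ∈ orliczSpace Φ μ) (hg : g ∈ orliczHeart Φ.conjugate μ) :
    Integrable (fun x => f x * g x) μ := by
  obtain ⟨a, ha, hfa⟩ := luxemburgNorm_lt_top_iff.1 hf
  have hg1 := hg.2 1 one_pos
  refine ⟨f.aestronglyMeasurable.mul g.aestronglyMeasurable, ?_⟩
  have hm : Measurable fun x => Φ (‖f x‖₊ / a) :=
    Φ.mono.measurable.comp (f.measurable.nnnorm.div_const a)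
  have key : ∀ x, ‖f x * g x‖ₑ ≤ a * (Φ (‖f x‖₊ / a) + Φ.conjugate (‖g x‖₊ / 1)) := by
    intro x
    have h := Φ.mul_le_add_conjugateFun (‖f x‖₊ / a) (‖g x‖₊ / 1)
    calc ‖f x * g x‖ₑ = a * (((‖f x‖₊ / a : ℝ≥0) : ℝ≥0∞) * ((‖g x‖₊ / 1 : ℝ≥0) : ℝ≥0∞)) := by
          rw [enorm_eq_nnnorm, nnnorm_mul, ← ENNReal.coe_mul, ← ENNReal.coe_mul]
          congr 1
          field_simp
      _ ≤ _ := by gcongr; exact h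
  refine lt_of_le_of_lt (lintegral_mono key) ?_
  rw [lintegral_const_mul' _ _ ENNReal.coe_ne_top, lintegral_add_left hm]
  exact ENNReal.mul_lt_top ENNReal.coe_lt_top
    (ENNReal.add_lt_top.2 ⟨hfa.trans_lt ENNReal.one_lt_top, hg1⟩)

/-- The duality `⟨f, g⟩ = ∫ f g dμ` between `L_Φ(μ)` and `H_Ψ(μ)`, where `Ψ` is the conjugate
of `Φ`. -/
noncomputable def orliczPairing (Φ : OrliczFunction) (μ : Measure Ω) :
    orliczSpace Φ μ →ₗ[ℝ] orliczHeart Φ.conjugate μ →ₗ[ℝ] ℝ :=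
  LinearMap.mk₂ ℝ
    (fun f g => ∫ x, (f : Ω →ₘ[μ] ℝ) x * (g : Ω →ₘ[μ] ℝ) x ∂μ)
    (fun f f' g => by
      rw [← integral_add (integrable_orlicz_mul f.2 g.2) (integrable_orlicz_mul f'.2 g.2)]
      refine integral_congr_ae ?_
      filter_upwards [AEEqFun.coeFn_add (f : Ω →ₘ[μ] ℝ) f'] with x hx
      rw [Submodule.coe_add, hx, Pi.add_apply, add_mul])
    (fun k f g => by
      rw [smul_eq_mul, ← integral_const_mul]
      refine integral_congr_ae ?_
      filter_upwards [AEEqFun.coeFn_smul k (f : Ω →ₘ[μ] ℝ)] with x hx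
      rw [Submodule.coe_smul, hx, Pi.smul_apply, smul_eq_mul, mul_assoc])
    (fun f g g' => by
      rw [← integral_add (integrable_orlicz_mul f.2 g.2) (integrable_orlicz_mul f.2 g'.2)]
      refine integral_congr_ae ?_
      filter_upwards [AEEqFun.coeFn_add (g : Ω →ₘ[μ] ℝ) g'] with x hx
      rw [Submodule.coe_add, hx, Pi.add_apply, mul_add])
    (fun k f g => by
      rw [smul_eq_mul, ← integral_const_mul]
      refine integral_congr_ae ?_
      filter_upwards [AEEqFun.coeFn_smul k (g : Ω →ₘ[μ] ℝ)] with x hx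
      rw [Submodule.coe_smul, hx, Pi.smul_apply, smul_eq_mul, mul_left_comm])

/-- The weak* topology `σ(L_Φ(μ), H_Ψ(μ))` on `L_Φ(μ)`. -/
noncomputable abbrev orliczWeakStar (Φ : OrliczFunction) (μ : Measure Ω) :
    TopologicalSpace (orliczSpace Φ μ) :=
  WeakBilin.instTopologicalSpace (orliczPairing Φ μ)

end OrliczSpaces

/-!
Superlinearity of `Φ` makes the conjugate `Ψ` finite everywhere, so that every bounded function
supported on a set `A` of finite measure belongs to the heart `H_Ψ(μ)`. Testing against these
functions shows that `f ↦ f|_A` maps `L_Φ(μ)` into `L¹(A)`, continuously from the weak* topology to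
the weak topology `σ(L¹(A), L^∞(A))`. Hence if `f` lies in the weak* closure of a convex set `C`,
then `f|_A` lies in the weak closure, and by the Hahn–Banach theorem in the norm closure, of the
convex set `C|_A` in `L¹(A)`: this is `exists_setLIntegral_enorm_sub_lt`. No boundedness of `C` is
needed.

Applying this to an increasing sequence of sets `A n` of finite measure with union `Ω` gives
`u n ∈ C` with `∑ₙ ∫_{A n} |u n - f| dμ < ∞`, which forces `u n → f` almost everywhere
(`ae_tendsto_of_tsum_setLIntegral_ne_top`).

The separation argument needs that a continuous functional on `L¹` of a finite measure is
integration against a bounded function (`exists_bounded_representative`). It is derived from the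
Riesz representation theorem in `L²`.
-/

namespace OrliczFunction

theorem conjugate_lt_top_of_superlinear {Φ : OrliczFunction}
    (hΦ : Tendsto (fun t : ℝ≥0 => Φ t / (t : ℝ≥0∞)) atTop (𝓝 ⊤)) (s : ℝ≥0) :
    Φ.conjugate s < ⊤ := by
  obtain ⟨T, hT⟩ := eventually_atTop.1
    (hΦ.eventually (lt_mem_nhds (ENNReal.coe_lt_top (r := s))))
  refine lt_of_le_of_lt (b := (T : ℝ≥0∞) * s) (iSup_le fun t => ?_)
    (ENNReal.mul_lt_top ENNReal.coe_lt_top ENNReal.coe_lt_top)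
  rcases le_total t T with h | h
  · exact tsub_le_self.trans (by gcongr)
  · have := ENNReal.mul_le_of_le_div (hT t h).le
    rw [mul_comm, tsub_eq_zero_of_le this]
    exact zero_le

theorem map_mul_le (Θ : OrliczFunction) {a : ℝ≥0} (ha : a ≤ 1) (t : ℝ≥0) :
    Θ (a * t) ≤ a * Θ t := by
  have := Θ.convex.2 (Set.mem_univ t) (Set.mem_univ 0) (zero_le : 0 ≤ a)
    (zero_le : 0 ≤ 1 - a) (add_tsub_cancel_of_le ha)
  simpa [Θ.map_zero, ENNReal.smul_def] using this

end OrliczFunction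

section Heart

variable {Ω : Type*} [MeasurableSpace Ω] {μ : Measure Ω}

/-- The hypothesis on `g` says that a.e. `|g| ≤ M` on `A` and `g = 0` off `A`. -/
theorem orliczModular_le_of_bound (Θ : OrliczFunction) {A : Set Ω} (hA : MeasurableSet A)
    {g : Ω →ₘ[μ] ℝ} {M : ℝ≥0} (hg : ∀ᵐ x ∂μ, ‖g x‖₊ ≤ A.indicator (fun _ => M) x) (c : ℝ≥0) :
    orliczModular Θ μ c g ≤ Θ (M / c) * μ A := by
  rw [← lintegral_indicator_const hA]
  refine lintegral_mono_ae ?_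
  filter_upwards [hg] with x hx
  by_cases hxA : x ∈ A
  · rw [Set.indicator_of_mem hxA] at hx ⊢
    exact Θ.mono (by gcongr)
  · rw [Set.indicator_of_notMem hxA] at hx ⊢
    rw [nonpos_iff_eq_zero.1 hx, zero_div, Θ.map_zero]

theorem mem_orliczHeart_of_bound {Θ : OrliczFunction} (hΘ : ∀ s, Θ s < ⊤) {A : Set Ω}
    (hA : MeasurableSet A) (hμA : μ A ≠ ∞) {g : Ω →ₘ[μ] ℝ} {M : ℝ≥0}
    (hg : ∀ᵐ x ∂μ, ‖g x‖₊ ≤ A.indicator (fun _ => M) x) : g ∈ orliczHeart Θ μ := by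
  refine ⟨luxemburgNorm_lt_top_iff.2 ?_, fun c _ =>
    (orliczModular_le_of_bound Θ hA hg c).trans_lt (ENNReal.mul_lt_top (hΘ _) hμA.lt_top)⟩
  -- By convexity `Θ (M / (K + 1)) ≤ Θ M / (K + 1)`, and `Θ M * μ A = K`.
  set K : ℝ≥0 := (Θ M * μ A).toNNReal
  have hK' : (K : ℝ≥0∞) = Θ M * μ A := ENNReal.coe_toNNReal (ENNReal.mul_ne_top (hΘ M).ne hμA)
  refine ⟨K + 1, by positivity, (orliczModular_le_of_bound Θ hA hg _).trans ?_⟩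
  have h1 : (K + 1)⁻¹ ≤ 1 := inv_le_one_of_one_le₀ le_add_self
  calc Θ (M / (K + 1)) * μ A
      ≤ ((K + 1)⁻¹ : ℝ≥0) * Θ M * μ A := by
        rw [div_eq_inv_mul]; gcongr; exact Θ.map_mul_le h1 M
    _ = (((K + 1)⁻¹ * K : ℝ≥0) : ℝ≥0∞) := by rw [mul_assoc, ← hK', ENNReal.coe_mul]
    _ ≤ 1 := by
        rw [ENNReal.coe_le_one_iff, ← div_eq_inv_mul]
        exact div_le_one_of_le₀ le_self_add zero_le

end Heart

section LOneDual

variable {Ω : Type*} [MeasurableSpace Ω] {ν : Measure Ω} [IsFiniteMeasure ν]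

/-- `L^∞` represents the dual of `L¹` for a finite measure. The functional restricts to `L² ⊆ L¹`,
where it is the inner product with some `g₀`; its values on indicators bound the averages of `g₀`
by `‖φ‖`, so `|g₀| ≤ ‖φ‖` a.e., and density of simple functions gives the formula on `L¹`.
The representative is truncated so that the bound holds everywhere. -/
theorem exists_bounded_representative (φ : Lp ℝ 1 ν →L[ℝ] ℝ) :
    ∃ g : Ω → ℝ, Measurable g ∧ (∀ x, ‖g x‖ ≤ ‖φ‖) ∧ ∀ h : Lp ℝ 1 ν, φ h = ∫ x, h x * g x ∂ν := by
  -- The inclusion `L² ⊆ L¹`, as multiplication by the constant `1 ∈ L²`.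
  let ι : Lp ℝ 2 ν →L[ℝ] Lp ℝ 1 ν :=
    (ContinuousLinearMap.mul ℝ ℝ).holderL ν 2 2 1 (Lp.const 2 ν 1)
  have hι (f : Lp ℝ 2 ν) : ι f =ᵐ[ν] f := by
    filter_upwards [(ContinuousLinearMap.mul ℝ ℝ).coeFn_holder (r := 1) (Lp.const 2 ν (1 : ℝ)) f,
      Lp.coeFn_const 2 ν (1 : ℝ)] with x hx hx'
    change ((ContinuousLinearMap.mul ℝ ℝ).holder 1 (Lp.const 2 ν (1 : ℝ)) f) x = f x
    rw [hx, hx']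
    simp
  let g₀ : Lp ℝ 2 ν := (InnerProductSpace.toDual ℝ (Lp ℝ 2 ν)).symm (φ ∘L ι)
  have hg₀ : Integrable g₀ ν := (Lp.memLp g₀).integrable (by norm_num)
  have hind (c : ℝ) {s : Set Ω} (hs : MeasurableSet s) :
      φ (indicatorConstLp 1 hs (measure_ne_top ν s) c) = c * ∫ x in s, g₀ x ∂ν := by
    have h1 : indicatorConstLp 1 hs (measure_ne_top ν s) c =
        ι (indicatorConstLp 2 hs (measure_ne_top ν s) c) := by
      refine Lp.ext ?_
      exact indicatorConstLp_coeFn.trans (indicatorConstLp_coeFn.symm.trans (hι _).symm)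
    have h2 : φ (ι (indicatorConstLp 2 hs (measure_ne_top ν s) c)) =
        inner ℝ g₀ (indicatorConstLp 2 hs (measure_ne_top ν s) c) :=
      (InnerProductSpace.toDual_symm_apply (y := φ ∘L ι)).symm
    rw [h1, h2, real_inner_comm, L2.inner_indicatorConstLp_eq_inner_setIntegral ℝ hs
      (measure_ne_top ν s) c]
    simp [mul_comm]
  have habs {s : Set Ω} (hs : MeasurableSet s) : |∫ x in s, g₀ x ∂ν| ≤ ‖φ‖ * ν.real s := by
    have h := φ.le_opNorm (indicatorConstLp 1 hs (measure_ne_top ν s) 1)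
    rwa [hind, one_mul, norm_indicatorConstLp one_ne_zero ENNReal.one_ne_top, norm_one, one_mul,
      ENNReal.toReal_one, div_one, Real.rpow_one] at h
  have hle : g₀ ≤ᵐ[ν] fun _ => ‖φ‖ :=
    ae_le_of_forall_setIntegral_le hg₀ (integrable_const _) fun s hs _ => by
      rw [setIntegral_const, smul_eq_mul, mul_comm]
      exact (le_abs_self _).trans (habs hs)
  have hge : (fun _ => -‖φ‖) ≤ᵐ[ν] g₀ :=
    ae_le_of_forall_setIntegral_le (integrable_const _) hg₀ fun s hs _ => by
      rw [setIntegral_const, smul_eq_mul, mul_neg, mul_comm]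
      exact neg_le_of_abs_le (habs hs)
  let g : Ω → ℝ := fun x => max (-‖φ‖) (min ‖φ‖ (g₀ x))
  have hgm : Measurable g :=
    measurable_const.max (measurable_const.min (Lp.stronglyMeasurable g₀).measurable)
  have hgb (x : Ω) : ‖g x‖ ≤ ‖φ‖ :=
    abs_le.2 ⟨le_max_left _ _, max_le (neg_le_self (norm_nonneg φ)) (min_le_left _ _)⟩
  have hgg : g =ᵐ[ν] g₀ := by
    filter_upwards [hle, hge] with x h1 h2
    change max (-‖φ‖) (min ‖φ‖ (g₀ x)) = g₀ x
    rw [min_eq_right h1, max_eq_right h2]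
  have hgLp : MemLp g ∞ ν := memLp_top_of_bound hgm.aestronglyMeasurable ‖φ‖ (ae_of_all _ hgb)
  let ψ : Lp ℝ 1 ν →L[ℝ] ℝ :=
    ((ContinuousLinearMap.mul ℝ ℝ).lpPairing ν 1 ∞).flip hgLp.toLp
  have hψ (h : Lp ℝ 1 ν) : ψ h = ∫ x, h x * g x ∂ν := by
    change (ContinuousLinearMap.mul ℝ ℝ).lpPairing ν 1 ∞ h hgLp.toLp = _
    rw [ContinuousLinearMap.lpPairing_eq_integral]
    refine integral_congr_ae ?_
    filter_upwards [hgLp.coeFn_toLp] with x hx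
    simp [hx]
  refine ⟨g, hgm, hgb, fun h => ?_⟩
  rw [← hψ]
  refine Lp.induction ENNReal.one_ne_top (fun h => φ h = ψ h) (fun c s hs _ => ?_)
    (fun f₁ f₂ h₁ h₂ _ e₁ e₂ => ?_) (isClosed_eq φ.continuous ψ.continuous) h
  · rw [Lp.simpleFunc.coe_indicatorConst, hind, hψ, ← integral_const_mul, ← integral_indicator hs]
    refine integral_congr_ae ?_
    filter_upwards [hgg, indicatorConstLp_coeFn (p := 1) (hs := hs)
      (hμs := measure_ne_top ν s) (c := c)] with x hx hx'
    rw [hx', hx]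
    by_cases hxs : x ∈ s <;> simp [hxs]
  · rw [map_add, map_add, e₁, e₂]

end LOneDual

section Closure

variable {Ω : Type*} [MeasurableSpace Ω] {μ : Measure Ω} {Φ : OrliczFunction}

/-- The indicator of `A` lies in the heart of the conjugate, so pairing with it is integrable. -/
theorem integrableOn_of_mem_orliczSpace (hΨ : ∀ s, Φ.conjugate s < ⊤) {f : Ω →ₘ[μ] ℝ}
    (hf : f ∈ orliczSpace Φ μ) {A : Set Ω} (hA : MeasurableSet A) (hμA : μ A ≠ ∞) :
    IntegrableOn f A μ := by
  have hm : AEStronglyMeasurable (A.indicator fun _ => (1 : ℝ)) μ :=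
    (measurable_const.indicator hA).aestronglyMeasurable
  have hae := AEEqFun.coeFn_mk _ hm
  have h1 : AEEqFun.mk _ hm ∈ orliczHeart Φ.conjugate μ := by
    refine mem_orliczHeart_of_bound hΨ hA hμA (M := 1) ?_
    filter_upwards [hae] with x hx
    rw [hx]
    by_cases hxA : x ∈ A <;> simp [hxA]
  rw [← integrable_indicator_iff hA]
  refine (integrable_orlicz_mul hf h1).congr ?_
  filter_upwards [hae] with x hx
  rw [hx]
  by_cases hxA : x ∈ A <;> simp [hxA]

/-- An element of the weak* closure of a convex set is approximated by elements of that set in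
`L¹(A)`, for each set `A` of finite measure. -/
theorem exists_setLIntegral_enorm_sub_lt (hΨ : ∀ s, Φ.conjugate s < ⊤)
    {C : Set (orliczSpace Φ μ)} (hC : Convex ℝ C) {f : orliczSpace Φ μ}
    (hf : f ∈ closure[orliczWeakStar Φ μ] C) {A : Set Ω} (hA : MeasurableSet A) (hμA : μ A ≠ ∞)
    {ε : ℝ≥0∞} (hε : 0 < ε) :
    ∃ u ∈ C, ∫⁻ x in A, ‖(u : Ω →ₘ[μ] ℝ) x - (f : Ω →ₘ[μ] ℝ) x‖ₑ ∂μ < ε := by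
  have : IsFiniteMeasure (μ.restrict A) := isFiniteMeasure_restrict.2 hμA
  have hint (h : orliczSpace Φ μ) : Integrable (h : Ω →ₘ[μ] ℝ) (μ.restrict A) :=
    integrableOn_of_mem_orliczSpace hΨ h.2 hA hμA
  -- Restriction to `A`, as a linear map into `L¹(A)`.
  let R : orliczSpace Φ μ →ₗ[ℝ] Lp ℝ 1 (μ.restrict A) :=
    { toFun := fun h => (hint h).toL1
      map_add' := fun h k => by
        rw [← Integrable.toL1_add, Integrable.toL1_eq_toL1_iff]
        exact ae_restrict_of_ae (AEEqFun.coeFn_add _ _)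
      map_smul' := fun c h => by
        rw [RingHom.id_apply, ← Integrable.toL1_smul', Integrable.toL1_eq_toL1_iff]
        exact ae_restrict_of_ae (AEEqFun.coeFn_smul _ _) }
  have hR (h : orliczSpace Φ μ) : R h =ᵐ[μ.restrict A] (h : Ω →ₘ[μ] ℝ) := (hint h).coeFn_toL1
  have hmem : R f ∈ closure (R '' C) := by
    by_contra hnot
    obtain ⟨φ, s, hφC, hφf⟩ := geometric_hahn_banach_closed_point
      (hC.linear_image R).closure isClosed_closure hnot
    obtain ⟨g, hgm, hgb, hφ⟩ := exists_bounded_representative φ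
    have hm : AEStronglyMeasurable (A.indicator g) μ := (hgm.indicator hA).aestronglyMeasurable
    have hae := AEEqFun.coeFn_mk _ hm
    have hG : AEEqFun.mk _ hm ∈ orliczHeart Φ.conjugate μ := by
      refine mem_orliczHeart_of_bound hΨ hA hμA (M := ‖φ‖₊) ?_
      filter_upwards [hae] with x hx
      rw [hx]
      by_cases hxA : x ∈ A
      · simp only [Set.indicator_of_mem hxA]
        exact hgb x
      · simp [hxA]
    -- The separating functional, composed with restriction, is the pairing with an element of the
    -- heart, so it is weak* continuous.
    have hpair (h : orliczSpace Φ μ) : orliczPairing Φ μ h ⟨_, hG⟩ = φ (R h) := by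
      change ∫ x, (h : Ω →ₘ[μ] ℝ) x * (AEEqFun.mk _ hm : Ω →ₘ[μ] ℝ) x ∂μ = _
      rw [hφ, integral_congr_ae ((hR h).mono fun x hx => congrArg (· * g x) hx),
        ← integral_indicator hA]
      refine integral_congr_ae ?_
      filter_upwards [hae] with x hx
      rw [hx]
      by_cases hxA : x ∈ A <;> simp [hxA]
    let := orliczWeakStar Φ μ
    have hcont : Continuous fun h : orliczSpace Φ μ => orliczPairing Φ μ h ⟨_, hG⟩ :=
      WeakBilin.eval_continuous (orliczPairing Φ μ) ⟨_, hG⟩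
    have hle : orliczPairing Φ μ f ⟨_, hG⟩ ≤ s :=
      closure_minimal (t := {h | orliczPairing Φ μ h ⟨_, hG⟩ ≤ s})
        (fun h hh => by
          rw [Set.mem_ofPred_eq, hpair]
          exact (hφC _ (subset_closure ⟨h, hh, rfl⟩)).le)
        (isClosed_le hcont continuous_const) hf
    rw [hpair] at hle
    exact hle.not_gt hφf
  obtain ⟨_, ⟨u, hu, rfl⟩, hlt⟩ := EMetric.mem_closure_iff.1 hmem ε hε
  refine ⟨u, hu, ?_⟩
  rw [edist_comm] at hlt
  change edist ((hint u).toL1) ((hint f).toL1) < ε at hlt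
  rw [Integrable.edist_toL1_toL1] at hlt
  simpa [edist_eq_enorm_sub] using hlt

end Closure

theorem ae_tendsto_of_tsum_setLIntegral_ne_top {Ω : Type*} [MeasurableSpace Ω] {μ : Measure Ω}
    {A : ℕ → Set Ω} (hA : ∀ n, MeasurableSet (A n)) (hA_ev : ∀ x, ∀ᶠ n in atTop, x ∈ A n)
    {u : ℕ → Ω → ℝ} {f : Ω → ℝ} (hu : ∀ n, AEMeasurable (u n) μ) (hf : AEMeasurable f μ)
    (hsum : ∑' n, ∫⁻ x in A n, ‖u n x - f x‖ₑ ∂μ ≠ ∞) :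
    ∀ᵐ x ∂μ, Tendsto (fun n => u n x) atTop (𝓝 (f x)) := by
  have hm (n : ℕ) : AEMeasurable ((A n).indicator fun x => ‖u n x - f x‖ₑ) μ :=
    ((hu n).sub hf).enorm.indicator (hA n)
  simp_rw [← lintegral_indicator (hA _)] at hsum
  rw [← lintegral_tsum hm] at hsum
  filter_upwards [ae_lt_top' (AEMeasurable.tsum hm) hsum] with x hx
  have h0 := ENNReal.tendsto_atTop_zero_of_tsum_ne_top hx.ne
  rw [tendsto_iff_edist_tendsto_0]
  refine h0.congr' ?_
  filter_upwards [hA_ev x] with n hn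
  rw [Set.indicator_of_mem hn, edist_eq_enorm_sub]

theorem theorem2p3 {Ω : Type*} [MeasurableSpace Ω] (μ : Measure Ω) [SigmaFinite μ]
    (Φ : OrliczFunction)
    (hΦ : Tendsto (fun t : ℝ≥0 => Φ t / (t : ℝ≥0∞)) atTop (𝓝 ⊤))
    (C : Set (orliczSpace Φ μ)) (hC : Convex ℝ C)
    (f : orliczSpace Φ μ) (hf : f ∈ closure[orliczWeakStar Φ μ] C) :
    ∃ u : ℕ → orliczSpace Φ μ, (∀ n, u n ∈ C) ∧
      ∀ᵐ x ∂μ, Tendsto (fun n => (u n : Ω →ₘ[μ] ℝ) x) atTop (𝓝 ((f : Ω →ₘ[μ] ℝ) x)) := by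
  obtain ⟨ε, hε, hεsum⟩ := ENNReal.exists_pos_sum_of_countable one_ne_zero ℕ
  choose u huC hu using fun n => exists_setLIntegral_enorm_sub_lt
    (OrliczFunction.conjugate_lt_top_of_superlinear hΦ) hC hf (measurableSet_spanningSets μ n)
    (measure_spanningSets_lt_top μ n).ne (ENNReal.coe_pos.2 (hε n))
  refine ⟨u, huC, ae_tendsto_of_tsum_setLIntegral_ne_top (measurableSet_spanningSets μ)
    (eventually_mem_spanningSets μ) (fun n => (u n : Ω →ₘ[μ] ℝ).aemeasurable)
    (f : Ω →ₘ[μ] ℝ).aemeasurable ?_⟩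
  exact ((ENNReal.tsum_le_tsum fun n => (hu n).le).trans_lt
    (hεsum.trans ENNReal.one_lt_top)).ne
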